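/- A graph is a (unit) distance graph in $\mathbb{R}^d$ if its vertices are distinct points of $\mathbb{R}^d$ and any two adjacent vertices are at Euclidean distance exactly $1$ (non-adjacent vertices may also be at distance $1$). The distance Ramsey number $R_D(s,t,d)$ is the minimum $n$ such that for every graph $G$ on $n$ vertices, either $G$ contains an induced $s$-vertex subgraph isomorphic to a distance graph in $\mathbb{R}^d$, or the complement $\bar G$ contains an induced $t$-vertex subgraph isomorphic to a distance graph in $\mathbb{R}^d$. Then for $d\in\{4,5\}$ there is a function $\varepsilon:\mathbb{N}\to\mathbb{R}$ with $\varepsilon(s)\to 0$ as $s\to\infty$ such that for all $s\ge 1$ $$R_D(s,s,d)\ \ge\ \left(\frac87\right)^{\frac s6(1+\varepsilon(s))}.$$ Here $(8/7)^{1/6}=2^{c}$ with $|c-0.032107|<10^{-6}$, so the right-hand side is $2^{cs(1+\varepsilon(s))}$ with $c\approx 0.0321$. -/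

import Mathlib

open Filter Topology

/-- A graph is (isomorphic to) a unit distance graph in `ℝ^d`: its vertices can be identified with
pairwise distinct points of `ℝ^d` so that the endpoints of every edge are at distance exactly `1`.
Non-adjacent vertices may also be at distance `1`. -/
def IsDistanceGraph {V : Type*} (G : SimpleGraph V) (d : ℕ) : Prop :=
  ∃ f : V → EuclideanSpace ℝ (Fin d), Function.Injective f ∧
    ∀ u v : V, G.Adj u v → dist (f u) (f v) = 1

/-- `G` contains an induced `s`-vertex subgraph isomorphic to a distance graph in `ℝ^d`. -/
def HasInducedDistanceGraph {V : Type*} (G : SimpleGraph V) (s d : ℕ) : Prop :=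
  ∃ S : Finset V, S.card = s ∧ IsDistanceGraph (G.induce (S : Set V)) d

/-- The distance Ramsey number `R_D(s, t, d)`: the minimum `n` such that for every graph `G` on `n`
vertices, `G` has an induced `s`-vertex distance graph in `ℝ^d` or the complement of `G` has an
induced `t`-vertex distance graph in `ℝ^d`. -/
noncomputable def distanceRamsey (s t d : ℕ) : ℕ :=
  sInf {n : ℕ | ∀ G : SimpleGraph (Fin n),
    HasInducedDistanceGraph G s d ∨ HasInducedDistanceGraph Gᶜ t d}

/-!
The lower bound is the first moment method applied to the uniform random graph on `Fin n`.

A distance graph in `ℝ^d` with `d < 6` contains no `K_{3,3,3}`: the parts of such a subgraph would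
span three mutually orthogonal planes (`IsDistanceGraph.not_completeTripartite`). By the power mean
inequality a graph on `s` vertices without `K_{3,3,3}` has only `O(s ^ (3 - 1 / 27))` triangles
(`card_triangles_pow_le`).

Identify the vertices of a candidate `s`-set with `ZMod s`. The triples with sum `c` form a family of
about `s ^ 2 / 6` pairwise edge-disjoint triples, and as `c` varies these families partition all
triples. Hence a distance graph has only `o(s ^ 2)` triangles in one of the `s` families
(`exists_tripleSystem_card_filter_le`). In a random graph the triples of one family are triangles
independently with probability `1 / 8`, so having `o(s ^ 2)` triangles in it has probability
`(7 / 8) ^ ((1 + o(1)) * s ^ 2 / 6)`; this is obtained from the generating function in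
`sum_powerset_pow_card_filter`. A union bound over the at most `n ^ s` embeddings of `ZMod s`, over
`c`, and over the graph and its complement (`exists_graph_forall_not_hasInducedDistanceGraph`)
succeeds for all `n` up to `(8 / 7) ^ ((1 - o(1)) * s / 6)`.

Since `distanceRamsey` is an infimum in `ℕ`, which would be `0` for the empty set, the finiteness of
the Ramsey numbers (`exists_ramsey_bound`) is also needed: an independent set is a distance graph.
-/

/-! ### Distance graphs in dimension at most five contain no `K_{3,3,3}` -/

/-- Three distinct points at distance `1` from `c` are not collinear, so they span a plane. -/
lemma finrank_vectorSpan_range_of_dist_eq_one {E : Type*} [NormedAddCommGroup E]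
    [InnerProductSpace ℝ E] {p : Fin 3 → E} (hp : Function.Injective p) {c : E}
    (h : ∀ i, dist (p i) c = 1) : Module.finrank ℝ (vectorSpan ℝ (Set.range p)) = 2 := by
  have hs : EuclideanGeometry.Cospherical (Set.range p) :=
    ⟨c, 1, by rintro _ ⟨i, rfl⟩; exact h i⟩
  exact (hs.affineIndependent subset_rfl hp).finrank_vectorSpan (by simp)

lemma vectorSpan_isOrtho_of_dist_eq_one {E : Type*} [NormedAddCommGroup E]
    [InnerProductSpace ℝ E] {p q : Fin 3 → E} (h : ∀ i j, dist (p i) (q j) = 1) :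
    vectorSpan ℝ (Set.range p) ⟂ vectorSpan ℝ (Set.range q) := by
  rw [vectorSpan_def, vectorSpan_def, Submodule.isOrtho_span]
  rintro _ ⟨_, ⟨i, rfl⟩, _, ⟨i', rfl⟩, rfl⟩ _ ⟨_, ⟨j, rfl⟩, _, ⟨j', rfl⟩, rfl⟩
  exact EuclideanGeometry.inner_vsub_vsub_of_dist_eq_of_dist_eq
    (by rw [dist_comm, h, dist_comm, h]) (by rw [dist_comm, h, dist_comm, h])

/-- The three planes spanned by the parts of a `K_{3,3,3}` would be mutually orthogonal, which
requires dimension six. -/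
lemma IsDistanceGraph.not_completeTripartite {V : Type*} {G : SimpleGraph V} {d : ℕ}
    (hG : IsDistanceGraph G d) (hd : d < 6) {x y z : Fin 3 → V} (hx : Function.Injective x)
    (hy : Function.Injective y) (hz : Function.Injective z)
    (hxy : ∀ i j, G.Adj (x i) (y j)) (hxz : ∀ i j, G.Adj (x i) (z j))
    (hyz : ∀ i j, G.Adj (y i) (z j)) : False := by
  obtain ⟨f, hf, hd1⟩ := hG
  have hX := finrank_vectorSpan_range_of_dist_eq_one (hf.comp hx) (c := f (y 0))
    fun i => hd1 _ _ (hxy i 0)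
  have hY := finrank_vectorSpan_range_of_dist_eq_one (hf.comp hy) (c := f (z 0))
    fun i => hd1 _ _ (hyz i 0)
  have hZ := finrank_vectorSpan_range_of_dist_eq_one (hf.comp hz) (c := f (y 0))
    fun i => hd1 _ _ (hyz 0 i).symm
  have oXY := vectorSpan_isOrtho_of_dist_eq_one (p := f ∘ x) (q := f ∘ y)
    fun i j => hd1 _ _ (hxy i j)
  have oXZ := vectorSpan_isOrtho_of_dist_eq_one (p := f ∘ x) (q := f ∘ z)
    fun i j => hd1 _ _ (hxz i j)
  have oYZ := vectorSpan_isOrtho_of_dist_eq_one (p := f ∘ y) (q := f ∘ z)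
    fun i j => hd1 _ _ (hyz i j)
  set X := vectorSpan ℝ (Set.range (f ∘ x))
  set Y := vectorSpan ℝ (Set.range (f ∘ y))
  set Z := vectorSpan ℝ (Set.range (f ∘ z))
  have h1 := Submodule.finrank_sup_add_finrank_inf_eq X Y
  have h2 := Submodule.finrank_sup_add_finrank_inf_eq (X ⊔ Y) Z
  rw [oXY.disjoint.eq_bot, finrank_bot] at h1
  rw [(Submodule.isOrtho_sup_left.2 ⟨oXZ, oYZ⟩).disjoint.eq_bot, finrank_bot] at h2
  have h3 := Submodule.finrank_le (X ⊔ Y ⊔ Z)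
  rw [finrank_euclideanSpace_fin] at h3
  omega

/-! ### Triangles in graphs without `K_{3,3,3}` -/

lemma cube_sum_sum_le {ι κ : Type*} [Fintype ι] [Fintype κ] [Nonempty ι] (g : ι → κ → ℝ)
    (hg : ∀ i k, 0 ≤ g i k) :
    (∑ i, ∑ k, g i k) ^ 3 ≤
      (Fintype.card ι : ℝ) ^ 2 * ∑ i, ∑ k : Fin 3 → κ, ∏ j, g i (k j) := by
  have h := pow_sum_div_card_le_sum_pow (s := Finset.univ) (f := fun i => ∑ k, g i k)
    (fun i _ => Finset.sum_nonneg fun k _ => hg i k) 2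
  have hc : (0 : ℝ) < (Fintype.card ι : ℝ) ^ 2 := by
    have : 0 < Fintype.card ι := Fintype.card_pos
    positivity
  rw [Finset.card_univ, div_le_iff₀ hc, mul_comm] at h
  refine h.trans (le_of_eq ?_)
  congr 1
  refine Finset.sum_congr rfl fun i _ => ?_
  rw [Finset.sum_pow']
  simp

/-- The power mean inequality, applied once in each variable, bounds the density of homomorphic
copies of `K_{3,3,3}` below by the 27th power of the triangle density. -/
lemma pow_sum_triple_le {V : Type*} [Fintype V] [Nonempty V] (f : V → V → V → ℝ)
    (hf : ∀ x y z, 0 ≤ f x y z) :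
    (∑ x, ∑ y, ∑ z, f x y z) ^ 27 ≤
      (Fintype.card V : ℝ) ^ 72 *
        ∑ z : Fin 3 → V, ∑ y : Fin 3 → V, ∑ x : Fin 3 → V, ∏ i, ∏ j, ∏ k, f (x i) (y j) (z k) := by
  have h1 := cube_sum_sum_le (ι := V × V) (fun p z => f p.1 p.2 z) fun p z => hf _ _ _
  have h2 := cube_sum_sum_le (ι := (Fin 3 → V) × V)
    (fun p y => ∏ k, f p.2 y (p.1 k)) fun p y => Finset.prod_nonneg fun _ _ => hf _ _ _
  have h3 := cube_sum_sum_le (ι := (Fin 3 → V) × (Fin 3 → V))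
    (fun p x => ∏ j, ∏ k, f x (p.2 j) (p.1 k))
    fun p y => Finset.prod_nonneg fun _ _ => Finset.prod_nonneg fun _ _ => hf _ _ _
  have e1 : ∑ p : V × V, ∑ k : Fin 3 → V, ∏ j, f p.1 p.2 (k j) =
      ∑ p : (Fin 3 → V) × V, ∑ y, ∏ k, f p.2 y (p.1 k) := by
    simp only [Fintype.sum_prod_type]
    rw [Finset.sum_comm' (t' := Finset.univ) (s' := fun _ => Finset.univ) (by simp)]
    simp_rw [Finset.sum_comm (s := (Finset.univ : Finset V))
      (t := (Finset.univ : Finset (Fin 3 → V)))]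
    exact Finset.sum_congr rfl fun _ _ => Finset.sum_comm
  have e2 : ∑ p : (Fin 3 → V) × V, ∑ y : Fin 3 → V, ∏ j, ∏ k, f p.2 (y j) (p.1 k) =
      ∑ p : (Fin 3 → V) × (Fin 3 → V), ∑ x, ∏ j, ∏ k, f x (p.2 j) (p.1 k) := by
    simp only [Fintype.sum_prod_type]
    exact Finset.sum_congr rfl fun _ _ => Finset.sum_comm
  rw [e1] at h1
  rw [e2] at h2
  simp only [Fintype.sum_prod_type, Fintype.card_prod, Fintype.card_pi, Finset.prod_const,
    Finset.card_univ, Fintype.card_fin, Nat.cast_mul, Nat.cast_pow] at h1 h2 h3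
  set m : ℝ := (Fintype.card V : ℝ)
  have hm : 0 ≤ m := Nat.cast_nonneg _
  set A := ∑ x, ∑ y, ∑ z, f x y z
  set B := ∑ z : Fin 3 → V, ∑ x, ∑ y, ∏ k, f x y (z k)
  set C := ∑ z : Fin 3 → V, ∑ y : Fin 3 → V, ∑ x, ∏ j, ∏ k, f x (y j) (z k)
  have hA : 0 ≤ A := Finset.sum_nonneg fun _ _ => Finset.sum_nonneg fun _ _ =>
    Finset.sum_nonneg fun _ _ => hf _ _ _
  have hB : 0 ≤ B := Finset.sum_nonneg fun _ _ => Finset.sum_nonneg fun _ _ =>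
    Finset.sum_nonneg fun _ _ => Finset.prod_nonneg fun _ _ => hf _ _ _
  calc A ^ 27 = ((A ^ 3) ^ 3) ^ 3 := by ring
    _ ≤ (((m * m) ^ 2 * B) ^ 3) ^ 3 := by gcongr
    _ = m ^ 36 * (B ^ 3) ^ 3 := by ring
    _ ≤ m ^ 36 * ((m ^ 3 * m) ^ 2 * C) ^ 3 := by gcongr
    _ = m ^ 60 * C ^ 3 := by ring
    _ ≤ m ^ 60 * ((m ^ 3 * m ^ 3) ^ 2 * ∑ z : Fin 3 → V, ∑ y : Fin 3 → V, ∑ x : Fin 3 → V,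
          ∏ i, ∏ j, ∏ k, f (x i) (y j) (z k)) := by gcongr
    _ = _ := by ring

lemma card_not_injective_fin_three_le (V : Type*) [Fintype V] [DecidableEq V] :
    (Finset.univ.filter fun x : Fin 3 → V => ¬ Function.Injective x).card ≤
      3 * Fintype.card V ^ 2 := by
  have key : ∀ i j : Fin 3, i ≠ j → ∃ k, ∀ l, l = k ∨ l = i ∨ l = j := by decide
  have h : (Finset.univ.filter fun x : Fin 3 → V => ¬ Function.Injective x) ⊆
      Finset.univ.image fun p : Fin 3 × V × V => fun l => if l = p.1 then p.2.1 else p.2.2 := by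
    intro x hx
    simp only [Finset.mem_filter, Finset.mem_univ, true_and, Function.Injective, not_forall] at hx
    obtain ⟨i, j, hij, hne⟩ := hx
    obtain ⟨k, hk⟩ := key i j hne
    refine Finset.mem_image.2 ⟨(k, x k, x i), Finset.mem_univ _, ?_⟩
    funext l
    dsimp only
    split_ifs with hl
    · rw [hl]
    · rcases hk l with h | h | h
      · exact absurd h hl
      · rw [h]
      · rw [h, hij]
  refine (Finset.card_le_card h).trans (Finset.card_image_le.trans (le_of_eq ?_))
  simp [sq]

open Classical in
/-- Every homomorphic copy of `K_{3,3,3}` repeats a vertex inside a part, and only `O(m ^ 8)` maps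
do. -/
lemma card_triangles_pow_le {V : Type*} [Fintype V] [Nonempty V] {G : SimpleGraph V}
    (hG : ∀ x y z : Fin 3 → V, Function.Injective x → Function.Injective y →
      Function.Injective z → (∀ i j, G.Adj (x i) (y j)) → (∀ i j, G.Adj (x i) (z j)) →
      (∀ i j, G.Adj (y i) (z j)) → False) :
    ((Finset.univ.filter fun p : V × V × V =>
      G.Adj p.1 p.2.1 ∧ G.Adj p.1 p.2.2 ∧ G.Adj p.2.1 p.2.2).card : ℝ) ^ 27 ≤
      9 * (Fintype.card V : ℝ) ^ 80 := by
  have h := pow_sum_triple_le (fun x y z : V => if G.Adj x y ∧ G.Adj x z ∧ G.Adj y z then 1 else 0)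
    fun _ _ _ => by split_ifs <;> norm_num
  have e : (∑ x, ∑ y, ∑ z, if G.Adj x y ∧ G.Adj x z ∧ G.Adj y z then (1 : ℝ) else 0) =
      ((Finset.univ.filter fun p : V × V × V =>
      G.Adj p.1 p.2.1 ∧ G.Adj p.1 p.2.2 ∧ G.Adj p.2.1 p.2.2).card : ℝ) := by
    rw [Finset.natCast_card_filter, Fintype.sum_prod_type]
    simp only [Fintype.sum_prod_type]
  rw [e] at h
  refine h.trans ?_
  let I : (Fin 3 → V) → ℝ := fun x => if ¬ Function.Injective x then 1 else 0
  have hI0 : ∀ x, 0 ≤ I x := fun x => by positivity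
  have hI : ∑ x, I x ≤ 3 * (Fintype.card V : ℝ) ^ 2 := by
    simp only [I]
    rw [Finset.sum_boole]
    exact_mod_cast card_not_injective_fin_three_le V
  have hle : ∀ z y x : Fin 3 → V,
      (∏ i, ∏ j, ∏ k, if G.Adj (x i) (y j) ∧ G.Adj (x i) (z k) ∧ G.Adj (y j) (z k)
        then (1 : ℝ) else 0) ≤ I z + I y + I x := by
    intro z y x
    by_cases hall : ∀ i j k, G.Adj (x i) (y j) ∧ G.Adj (x i) (z k) ∧ G.Adj (y j) (z k)
    · have h1 : (∏ i, ∏ j, ∏ k, if G.Adj (x i) (y j) ∧ G.Adj (x i) (z k) ∧ G.Adj (y j) (z k)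
          then (1 : ℝ) else 0) = 1 :=
        Finset.prod_eq_one fun i _ => Finset.prod_eq_one fun j _ => Finset.prod_eq_one fun k _ =>
          if_pos (hall i j k)
      rw [h1]
      by_contra hlt
      have hx : Function.Injective x := by
        by_contra hx
        have : I x = 1 := if_pos hx
        linarith [hI0 y, hI0 z]
      have hy : Function.Injective y := by
        by_contra hy
        have : I y = 1 := if_pos hy
        linarith [hI0 x, hI0 z]
      have hz : Function.Injective z := by
        by_contra hz
        have : I z = 1 := if_pos hz
        linarith [hI0 x, hI0 y]
      exact hG x y z hx hy hz (fun i j => (hall i j 0).1) (fun i j => (hall i 0 j).2.1)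
        fun i j => (hall 0 i j).2.2
    · simp only [not_forall] at hall
      obtain ⟨i, j, k, hn⟩ := hall
      rw [Finset.prod_eq_zero (Finset.mem_univ i) (Finset.prod_eq_zero (Finset.mem_univ j)
        (Finset.prod_eq_zero (Finset.mem_univ k) (if_neg hn)))]
      linarith [hI0 x, hI0 y, hI0 z]
  have hsum : (∑ z : Fin 3 → V, ∑ y : Fin 3 → V, ∑ x : Fin 3 → V,
      ∏ i, ∏ j, ∏ k, if G.Adj (x i) (y j) ∧ G.Adj (x i) (z k) ∧ G.Adj (y j) (z k)
        then (1 : ℝ) else 0) ≤ 9 * (Fintype.card V : ℝ) ^ 8 := by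
    calc _ ≤ ∑ z : Fin 3 → V, ∑ y : Fin 3 → V, ∑ x : Fin 3 → V, (I z + I y + I x) :=
          Finset.sum_le_sum fun z _ => Finset.sum_le_sum fun y _ => Finset.sum_le_sum fun x _ =>
            hle z y x
      _ = 3 * ((Fintype.card V : ℝ) ^ 6 * ∑ x, I x) := by
          simp only [Finset.sum_add_distrib, Finset.sum_const, ← Finset.mul_sum, Finset.card_univ,
            Fintype.card_pi, Finset.prod_const, Fintype.card_fin, nsmul_eq_mul, Nat.cast_pow]
          ring
      _ ≤ 3 * ((Fintype.card V : ℝ) ^ 6 * (3 * (Fintype.card V : ℝ) ^ 2)) := by gcongr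
      _ = _ := by ring
  calc _ ≤ (Fintype.card V : ℝ) ^ 72 * (9 * (Fintype.card V : ℝ) ^ 8) := by gcongr
    _ = _ := by ring

/-! ### The Ramsey number is finite -/

/-- Finiteness of the classical Ramsey numbers. -/
lemma exists_ramsey_bound (a b : ℕ) : ∃ n : ℕ, ∀ (V : Type) (G : SimpleGraph V) (U : Finset V),
    n ≤ U.card → (∃ S ⊆ U, S.card = a ∧ (S : Set V).Pairwise G.Adj) ∨
      ∃ S ⊆ U, S.card = b ∧ (S : Set V).Pairwise fun u v => ¬ G.Adj u v := by
  classical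
  induction a generalizing b with
  | zero => exact ⟨0, fun V G U _ => Or.inl ⟨∅, by simp⟩⟩
  | succ a iha =>
    induction b with
    | zero => exact ⟨0, fun V G U _ => Or.inr ⟨∅, by simp⟩⟩
    | succ b ihb =>
      obtain ⟨p, hp⟩ := iha (b + 1)
      obtain ⟨q, hq⟩ := ihb
      refine ⟨p + q + 1, fun V G U hU => ?_⟩
      obtain ⟨v, hv⟩ : U.Nonempty := Finset.card_pos.1 (by omega)
      have hsplit := Finset.card_filter_add_card_filter_not (s := U.erase v) (fun w => G.Adj v w)
      rw [Finset.card_erase_of_mem hv] at hsplit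
      set N := (U.erase v).filter fun w => G.Adj v w with hN
      set M := (U.erase v).filter fun w => ¬ G.Adj v w with hM
      have hNU : N ⊆ U := (Finset.filter_subset _ _).trans (Finset.erase_subset _ _)
      have hMU : M ⊆ U := (Finset.filter_subset _ _).trans (Finset.erase_subset _ _)
      have hNv : ∀ w ∈ N, w ≠ v ∧ G.Adj v w := fun w hw => by
        rw [hN, Finset.mem_filter, Finset.mem_erase] at hw
        exact ⟨hw.1.1, hw.2⟩
      have hMv : ∀ w ∈ M, w ≠ v ∧ ¬ G.Adj v w := fun w hw => by
        rw [hM, Finset.mem_filter, Finset.mem_erase] at hw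
        exact ⟨hw.1.1, hw.2⟩
      rcases (by omega : p ≤ N.card ∨ q ≤ M.card) with h | h
      · rcases hp V G N h with ⟨S, hS, hc, hS'⟩ | ⟨S, hS, hc, hS'⟩
        · refine Or.inl ⟨insert v S, Finset.insert_subset hv (hS.trans hNU), ?_, ?_⟩
          · rw [Finset.card_insert_of_notMem fun h => (hNv v (hS h)).1 rfl, hc]
          · rw [Finset.coe_insert]
            have := G.symm
            exact hS'.insert_of_symm fun w hw _ => (hNv w (hS hw)).2
        · exact Or.inr ⟨S, hS.trans hNU, hc, hS'⟩
      · rcases hq V G M h with ⟨S, hS, hc, hS'⟩ | ⟨S, hS, hc, hS'⟩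
        · exact Or.inl ⟨S, hS.trans hMU, hc, hS'⟩
        · refine Or.inr ⟨insert v S, Finset.insert_subset hv (hS.trans hMU), ?_, ?_⟩
          · rw [Finset.card_insert_of_notMem fun h => (hMv v (hS h)).1 rfl, hc]
          · rw [Finset.coe_insert]
            have : Std.Symm fun u v => ¬ G.Adj u v := ⟨fun _ _ h h' => h h'.symm⟩
            exact hS'.insert_of_symm fun w hw _ => (hMv w (hS hw)).2

lemma hasInducedDistanceGraph_of_pairwise_not_adj {n : ℕ} {G : SimpleGraph (Fin n)}
    {S : Finset (Fin n)} {d : ℕ} (hd : 0 < d)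
    (hS : (S : Set (Fin n)).Pairwise fun u v => ¬ G.Adj u v) :
    HasInducedDistanceGraph G S.card d := by
  refine ⟨S, rfl, fun v => EuclideanSpace.single ⟨0, hd⟩ (v.1.1 : ℝ), ?_, ?_⟩
  · intro u v h
    have := congrArg (fun x : EuclideanSpace ℝ (Fin d) => x ⟨0, hd⟩) h
    simp only [PiLp.single_apply, if_true] at this
    exact Subtype.ext (Fin.ext (by exact_mod_cast this))
  · intro u v h
    exact absurd h (hS u.2 v.2 fun h' => h.ne (Subtype.ext h'))

lemma distanceRamsey_mem (s t : ℕ) {d : ℕ} (hd : 0 < d)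
    (G : SimpleGraph (Fin (distanceRamsey s t d))) :
    HasInducedDistanceGraph G s d ∨ HasInducedDistanceGraph Gᶜ t d := by
  obtain ⟨n, hn⟩ := exists_ramsey_bound t s
  have hne : {n : ℕ | ∀ G : SimpleGraph (Fin n),
      HasInducedDistanceGraph G s d ∨ HasInducedDistanceGraph Gᶜ t d}.Nonempty := by
    refine ⟨n, fun G => ?_⟩
    rcases hn (Fin n) G Finset.univ (by simp) with ⟨S, -, rfl, hS⟩ | ⟨S, -, rfl, hS⟩
    · refine Or.inr (hasInducedDistanceGraph_of_pairwise_not_adj hd fun u hu v hv huv h => ?_)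
      exact ((SimpleGraph.compl_adj _ _ _).1 h).2 (hS hu hv huv)
    · exact Or.inl (hasInducedDistanceGraph_of_pairwise_not_adj hd hS)
  exact Nat.sInf_mem hne G

/-! ### The numerical constant -/

set_option exponentiation.threshold 1000 in
lemma abs_logb_two_eight_div_seven_sub_lt :
    |Real.logb 2 (8 / 7) / 6 - 0.032107| < 1 / 10 ^ 6 := by
  -- `89 / 462` and `131 / 680` enclose `logb 2 (8 / 7)` tightly enough.
  have h1 : (89 : ℝ) < 462 * Real.logb 2 (8 / 7) := by
    have := Real.logb_lt_logb (b := 2) (by norm_num) (by norm_num)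
      (by norm_num : (2 : ℝ) ^ 89 < (8 / 7) ^ 462)
    rw [Real.logb_pow, Real.logb_pow, Real.logb_self_eq_one (by norm_num)] at this
    norm_num at this ⊢
    exact this
  have h2 : 680 * Real.logb 2 (8 / 7) < (131 : ℝ) := by
    have := Real.logb_lt_logb (b := 2) (by norm_num) (by norm_num)
      (by norm_num : (8 / 7 : ℝ) ^ 680 < 2 ^ 131)
    rw [Real.logb_pow, Real.logb_pow, Real.logb_self_eq_one (by norm_num)] at this
    norm_num at this ⊢
    exact this
  rw [abs_lt]
  constructor <;> norm_num at h1 h2 ⊢ <;> linarith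

/-! ### Edge-disjoint triple systems -/

/-- The `3`-element subsets of a finite abelian group whose elements sum to `c`. -/
def tripleSystem {W : Type*} [AddCommGroup W] [Fintype W] [DecidableEq W] (c : W) :
    Finset (Finset W) :=
  (Finset.univ.powersetCard 3).filter fun t => ∑ w ∈ t, w = c

section TripleSystem

variable {W : Type*} [AddCommGroup W] [Fintype W] [DecidableEq W]

lemma mem_tripleSystem {c : W} {t : Finset W} :
    t ∈ tripleSystem c ↔ t.card = 3 ∧ ∑ w ∈ t, w = c := by
  simp [tripleSystem]

lemma pairwiseDisjoint_tripleSystem (c : W) :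
    (tripleSystem c : Set (Finset W)).PairwiseDisjoint fun t => t.powersetCard 2 := by
  -- A pair in a triple of the system determines the third element.
  have key : ∀ t ∈ tripleSystem c, ∀ e ∈ t.powersetCard 2, t = insert (c - ∑ w ∈ e, w) e := by
    intro t ht e he
    rw [mem_tripleSystem] at ht
    rw [Finset.mem_powersetCard] at he
    have h1 : (t \ e).card = 1 := by
      rw [Finset.card_sdiff_of_subset he.1, ht.1, he.2]
    obtain ⟨a, ha⟩ := Finset.card_eq_one.1 h1
    have h2 := Finset.sum_sdiff he.1 (f := fun w => w)
    rw [ha, Finset.sum_singleton, ht.2] at h2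
    rw [← h2, add_sub_cancel_right, Finset.insert_eq, ← ha, Finset.sdiff_union_of_subset he.1]
  intro t ht t' ht' hne
  refine Finset.disjoint_left.2 fun e he he' => hne ?_
  rw [key t ht e he, key t' ht' e he']

lemma sq_card_le_card_tripleSystem (c : W) :
    Fintype.card W ^ 2 ≤ 6 * (tripleSystem c).card + 3 * Fintype.card W := by
  classical
  set P : Finset (W × W) := Finset.univ.filter fun p =>
    p.1 ≠ p.2 ∧ c - p.1 - p.2 ≠ p.1 ∧ c - p.1 - p.2 ≠ p.2 with hP
  have h1 : P.card ≤ 6 * (tripleSystem c).card := by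
    refine Finset.card_le_mul_card_image_of_maps_to
      (f := fun p : W × W => ({p.1, p.2, c - p.1 - p.2} : Finset W)) ?_ 6 ?_
    · intro p hp
      simp only [hP, Finset.mem_univ, true_and, Finset.mem_filter] at hp
      rw [mem_tripleSystem]
      obtain ⟨ha, hb, hc⟩ := hp
      refine ⟨Finset.card_eq_three.2 ⟨_, _, _, ha, hb.symm, hc.symm, rfl⟩, ?_⟩
      rw [Finset.sum_insert, Finset.sum_insert, Finset.sum_singleton]
      · abel
      · simpa using hc.symm
      · simpa using ⟨ha, hb.symm⟩
    · intro t ht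
      rw [mem_tripleSystem] at ht
      have : (P.filter fun p : W × W => ({p.1, p.2, c - p.1 - p.2} : Finset W) = t) ⊆
          t.offDiag := by
        intro p hp
        rw [Finset.mem_filter, hP, Finset.mem_filter] at hp
        rw [Finset.mem_offDiag, ← hp.2]
        simpa using hp.1.2.1
      refine (Finset.card_le_card this).trans ?_
      rw [Finset.offDiag_card, ht.1]
  have h2 : (Finset.univ \ P).card ≤ 3 * Fintype.card W := by
    have : Finset.univ \ P ⊆ Finset.univ.image (fun x : W => (x, x)) ∪
        (Finset.univ.image (fun x : W => (x, c - x - x)) ∪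
          Finset.univ.image fun x : W => (c - x - x, x)) := by
      rintro ⟨x, y⟩ h
      simp only [hP, Finset.mem_sdiff, Finset.mem_univ, true_and, Finset.mem_filter, not_and_or,
        not_not] at h
      simp only [Finset.mem_union, Finset.mem_image, Finset.mem_univ, true_and, Prod.mk.injEq]
      rcases h with h | h | h
      · exact Or.inl ⟨x, rfl, h⟩
      · refine Or.inr (Or.inl ⟨x, rfl, ?_⟩)
        nth_rewrite 2 [← h]
        abel
      · refine Or.inr (Or.inr ⟨y, ?_, rfl⟩)
        nth_rewrite 2 [← h]
        abel
    refine (Finset.card_le_card this).trans ((Finset.card_union_le _ _).trans ?_)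
    have h := Finset.card_union_le (Finset.univ.image (fun x : W => (x, c - x - x)))
      (Finset.univ.image fun x : W => (c - x - x, x))
    have ha := Finset.card_image_le (s := Finset.univ) (f := fun x : W => (x, x))
    have hb := Finset.card_image_le (s := Finset.univ) (f := fun x : W => (x, c - x - x))
    have hc := Finset.card_image_le (s := Finset.univ) (f := fun x : W => (c - x - x, x))
    rw [Finset.card_univ] at ha hb hc
    omega
  have h3 := Finset.card_sdiff_add_card_eq_card (Finset.subset_univ P)
  rw [Finset.card_univ, Fintype.card_prod] at h3
  rw [sq]
  omega

open Classical in
/-- The triple systems partition all triples, so one of them contains at most the average number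
of triangles. -/
lemma exists_tripleSystem_card_filter_le (H : SimpleGraph W) {k : ℕ}
    (hk : (Finset.univ.filter fun p : W × W × W =>
      H.Adj p.1 p.2.1 ∧ H.Adj p.1 p.2.2 ∧ H.Adj p.2.1 p.2.2).card < (k + 1) * Fintype.card W) :
    ∃ c : W, ((tripleSystem c).filter fun t : Finset W => (t : Set W).Pairwise H.Adj).card ≤ k := by
  set Q : Finset (Finset W) :=
    (Finset.univ.powersetCard 3).filter fun t : Finset W => (t : Set W).Pairwise H.Adj with hQ
  have h1 : Q.card < (k + 1) * Fintype.card W := by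
    refine lt_of_le_of_lt (Finset.card_le_card_of_surjOn
      (fun p : W × W × W => ({p.1, p.2.1, p.2.2} : Finset W)) ?_) hk
    intro t ht
    simp only [hQ, Finset.coe_filter, Finset.mem_powersetCard, Set.mem_ofPred_eq] at ht
    obtain ⟨x, y, z, hxy, hxz, hyz, rfl⟩ := Finset.card_eq_three.1 ht.1.2
    refine ⟨(x, y, z), ?_, rfl⟩
    simp only [Finset.coe_filter, Finset.mem_univ, true_and, Set.mem_ofPred_eq]
    exact ⟨ht.2 (by simp) (by simp) hxy, ht.2 (by simp) (by simp) hxz,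
      ht.2 (by simp) (by simp) hyz⟩
  rw [Finset.card_eq_sum_card_fiberwise (f := fun t => ∑ w ∈ t, w) (t := Finset.univ)
    fun _ _ => Finset.mem_coe.2 (Finset.mem_univ _)] at h1
  have h2 : ∑ c : W, (Q.filter fun t => ∑ w ∈ t, w = c).card < ∑ _c : W, (k + 1) := by
    rw [Finset.sum_const, Finset.card_univ, smul_eq_mul, mul_comm]
    exact h1
  obtain ⟨c, -, hc⟩ := Finset.exists_lt_of_sum_lt h2
  refine ⟨c, ?_⟩
  rw [tripleSystem, Finset.filter_comm]
  exact Nat.lt_succ_iff.1 hc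

end TripleSystem

/-! ### Few sets of edges contain few triangles of a triple system -/

/-- The generating function of the number of sets `E i` contained in a random subset of `U`. For
disjoint sets of size three these events are independent of probability `1 / 8`. -/
lemma sum_powerset_pow_card_filter {ι α : Type*} [DecidableEq ι] [DecidableEq α] (x : ℝ)
    (E : ι → Finset α) (T : Finset ι) (hT : (T : Set ι).PairwiseDisjoint E)
    (hE : ∀ i ∈ T, (E i).card = 3) (U : Finset α) (hU : ∀ i ∈ T, E i ⊆ U) :
    (∑ A ∈ U.powerset, x ^ (T.filter fun i => E i ⊆ A).card) =
      2 ^ U.card * ((7 + x) / 8) ^ T.card := by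
  induction T using Finset.induction_on generalizing U with
  | empty => simp
  | insert a T ha ih =>
    have hadisj : ∀ i ∈ T, Disjoint (E i) (E a) := fun i hi =>
      hT (by simp [hi]) (by simp) (by rintro rfl; exact ha hi)
    have haU : E a ⊆ U := hU a (by simp)
    have ih' := ih (hT.subset (by simp)) (fun i hi => hE i (by simp [hi])) (U \ E a)
      fun i hi => Finset.subset_sdiff.2 ⟨hU i (by simp [hi]), hadisj i hi⟩
    have hsplit : (∑ A ∈ U.powerset, x ^ ((insert a T).filter fun i => E i ⊆ A).card) =
        ∑ p ∈ (E a).powerset ×ˢ (U \ E a).powerset,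
          (if p.1 = E a then x else 1) * x ^ (T.filter fun i => E i ⊆ p.2).card := by
      refine Finset.sum_nbij' (fun A => (A ∩ E a, A \ E a)) (fun p => p.1 ∪ p.2) ?_ ?_ ?_ ?_ ?_
      · intro A hA
        rw [Finset.mem_powerset] at hA
        simp only [Finset.mem_product, Finset.mem_powerset]
        exact ⟨Finset.inter_subset_right, Finset.sdiff_subset_sdiff hA subset_rfl⟩
      · rintro ⟨B, C⟩ hp
        simp only [Finset.mem_product, Finset.mem_powerset] at hp ⊢
        exact Finset.union_subset (hp.1.trans haU) (hp.2.trans Finset.sdiff_subset)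
      · intro A _
        rw [Finset.union_comm]
        exact Finset.sdiff_union_inter A (E a)
      · rintro ⟨B, C⟩ hp
        simp only [Finset.mem_product, Finset.mem_powerset, Finset.subset_sdiff] at hp
        obtain ⟨hB, -, hC⟩ := hp
        ext1
        · dsimp only
          rw [Finset.union_inter_distrib_right, Finset.inter_eq_left.2 hB,
            Finset.disjoint_iff_inter_eq_empty.1 hC, Finset.union_empty]
        · dsimp only
          rw [Finset.union_sdiff_distrib, Finset.sdiff_eq_empty_iff_subset.2 hB,
            Finset.sdiff_eq_self_of_disjoint hC, Finset.empty_union]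
      · intro A _
        have e : (T.filter fun i => E i ⊆ A \ E a) = T.filter fun i => E i ⊆ A := by
          refine Finset.filter_congr fun i hi => ?_
          rw [Finset.subset_sdiff]
          exact and_iff_left (hadisj i hi)
        simp only [e, Finset.filter_insert, Finset.inter_eq_right]
        split_ifs with h
        · rw [Finset.card_insert_of_notMem (by simp [ha]), pow_succ, mul_comm]
        · rw [one_mul]
    have hsum : ∑ B ∈ (E a).powerset, (if B = E a then x else 1) = 7 + x := by
      have e : ∀ B : Finset α, (if B = E a then x else 1) = 1 + if B = E a then x - 1 else 0 :=
        fun B => by split_ifs <;> ring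
      simp only [e]
      rw [Finset.sum_add_distrib, Finset.sum_ite_eq' , if_pos (by simp), Finset.sum_const,
        Finset.card_powerset, hE a (by simp)]
      norm_num
      ring
    have hprod : ∑ p ∈ (E a).powerset ×ˢ (U \ E a).powerset,
        (if p.1 = E a then x else 1) * x ^ (T.filter fun i => E i ⊆ p.2).card =
        (∑ B ∈ (E a).powerset, if B = E a then x else 1) *
          ∑ C ∈ (U \ E a).powerset, x ^ (T.filter fun i => E i ⊆ C).card := by
      rw [Finset.sum_mul_sum, Finset.sum_product]
    rw [hsplit, hprod, hsum, ih', Finset.card_insert_of_notMem ha,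
      Finset.card_sdiff_of_subset haU, hE a (by simp)]
    have h3 : 3 ≤ U.card := hE a (by simp) ▸ Finset.card_le_card haU
    obtain ⟨m, hm⟩ := Nat.exists_eq_add_of_le h3
    rw [hm, Nat.add_sub_cancel_left, pow_add, pow_succ]
    ring

/-- Markov's inequality for the generating function. -/
lemma card_filter_le_mul_pow_le {ι α : Type*} [DecidableEq ι] [DecidableEq α] [Fintype α] {x : ℝ}
    (hx0 : 0 < x) (hx1 : x ≤ 1) (E : ι → Finset α) (T : Finset ι)
    (hT : (T : Set ι).PairwiseDisjoint E) (hE : ∀ i ∈ T, (E i).card = 3) (k : ℕ) :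
    ((Finset.univ.filter fun A : Finset α => (T.filter fun i => E i ⊆ A).card ≤ k).card : ℝ) *
      x ^ k ≤ 2 ^ Fintype.card α * ((7 + x) / 8) ^ T.card := by
  rw [← Finset.card_univ (α := α), ← sum_powerset_pow_card_filter x E T hT hE Finset.univ
    fun _ _ => Finset.subset_univ _, Finset.powerset_univ, ← nsmul_eq_mul, ← Finset.sum_const]
  refine (Finset.sum_le_sum fun A hA => ?_).trans
    (Finset.sum_le_sum_of_subset_of_nonneg (Finset.filter_subset _ _) fun _ _ _ => by positivity)
  exact pow_le_pow_of_le_one hx0.le hx1 (Finset.mem_filter.1 hA).2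

/-! ### The union bound -/

/-- The graph whose edges are the two-element members of `A`. -/
def graphOfEdges {V : Type*} [DecidableEq V] (A : Finset (Finset V)) : SimpleGraph V where
  Adj u v := u ≠ v ∧ ({u, v} : Finset V) ∈ A
  symm := ⟨fun u v h => ⟨h.1.symm, by rw [Finset.pair_comm]; exact h.2⟩⟩
  loopless := ⟨fun _ h => h.1 rfl⟩

lemma compl_graphOfEdges {V : Type*} [DecidableEq V] [Fintype V] (A : Finset (Finset V)) :
    (graphOfEdges A)ᶜ = graphOfEdges Aᶜ := by
  ext u v
  simp only [SimpleGraph.compl_adj, graphOfEdges, Finset.mem_compl]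
  tauto

lemma HasInducedDistanceGraph.exists_comap {V W : Type*} [Fintype W] {G : SimpleGraph V}
    {d : ℕ} (h : HasInducedDistanceGraph G (Fintype.card W) d) :
    ∃ φ : W ↪ V, IsDistanceGraph (G.comap φ) d := by
  obtain ⟨S, hS, f, hf, hd⟩ := h
  have e : W ≃ (S : Set V) := Fintype.equivOfCardEq (by simp [hS])
  exact ⟨e.toEmbedding.trans (Function.Embedding.subtype _), f ∘ e, hf.comp e.injective,
    fun u v huv => hd _ _ huv⟩

open Classical in
/-- First moment method: the sets `A` for which `graphOfEdges A` has few triangles on the image of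
some triple system are too few to exhaust all graphs, even together with their complements. -/
lemma exists_graph_forall_not_hasInducedDistanceGraph {W V : Type*} [AddCommGroup W] [Fintype W]
    [DecidableEq W] [Fintype V] {d k : ℕ} {x : ℝ} (hx0 : 0 < x) (hx1 : x ≤ 1)
    (hk : ∀ H : SimpleGraph W, IsDistanceGraph H d → (Finset.univ.filter fun p : W × W × W =>
      H.Adj p.1 p.2.1 ∧ H.Adj p.1 p.2.2 ∧ H.Adj p.2.1 p.2.2).card < (k + 1) * Fintype.card W)
    {N : ℕ} (hN : ∀ c : W, N ≤ (tripleSystem c).card)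
    (hlt : 2 * ((Fintype.card V : ℝ) ^ Fintype.card W * Fintype.card W * ((7 + x) / 8) ^ N) <
      x ^ k) :
    ∃ G : SimpleGraph V, ¬ HasInducedDistanceGraph G (Fintype.card W) d ∧
      ¬ HasInducedDistanceGraph Gᶜ (Fintype.card W) d := by
  let E : (W ↪ V) → Finset W → Finset (Finset V) := fun φ t =>
    (t.powersetCard 2).map (Finset.mapEmbedding φ).toEmbedding
  let Bad : (W ↪ V) × W → Finset (Finset (Finset V)) := fun p => Finset.univ.filter fun A =>
    ((tripleSystem p.2).filter fun t => E p.1 t ⊆ A).card ≤ k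
  let B : Finset (Finset (Finset V)) := Finset.univ.biUnion Bad
  have hmem : ∀ A, HasInducedDistanceGraph (graphOfEdges A) (Fintype.card W) d → A ∈ B := by
    intro A hA
    obtain ⟨φ, hφ⟩ := hA.exists_comap
    obtain ⟨c, hc⟩ := exists_tripleSystem_card_filter_le _ (hk _ hφ)
    refine Finset.mem_biUnion.2 ⟨(φ, c), Finset.mem_univ _, Finset.mem_filter.2
      ⟨Finset.mem_univ _, (Finset.card_le_card fun t ht => ?_).trans hc⟩⟩
    rw [Finset.mem_filter] at ht ⊢
    refine ⟨ht.1, fun u hu v hv huv => ?_⟩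
    refine ⟨fun h => huv (φ.injective h), ht.2 (Finset.mem_map.2 ⟨{u, v}, ?_, ?_⟩)⟩
    · rw [Finset.mem_powersetCard]
      refine ⟨?_, Finset.card_pair huv⟩
      intro w hw
      rcases Finset.mem_insert.1 hw with rfl | hw
      · exact hu
      · rw [Finset.mem_singleton.1 hw]
        exact hv
    · simp [Finset.mapEmbedding_apply, Finset.map_insert]
  have hcard : ∀ p, ((Bad p).card : ℝ) * x ^ k ≤
      2 ^ Fintype.card (Finset V) * ((7 + x) / 8) ^ N := by
    rintro ⟨φ, c⟩
    have h := card_filter_le_mul_pow_le hx0 hx1 (E φ) (tripleSystem c)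
      (fun t ht t' ht' hne => (Finset.disjoint_map _).2
        (pairwiseDisjoint_tripleSystem c ht ht' hne))
      (fun t ht => by
        rw [Finset.card_map, Finset.card_powersetCard, (mem_tripleSystem.1 ht).1]; rfl) k
    refine le_trans h ?_
    gcongr 2 ^ _ * ?_
    exact pow_le_pow_of_le_one (by positivity) (by linarith) (hN c)
  have hB : (B.card : ℝ) * x ^ k ≤ (Fintype.card V : ℝ) ^ Fintype.card W * Fintype.card W *
      (2 ^ Fintype.card (Finset V) * ((7 + x) / 8) ^ N) := by
    have h1 : (B.card : ℝ) ≤ ∑ p, ((Bad p).card : ℝ) := by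
      exact_mod_cast Finset.card_biUnion_le
    have h2 : (Fintype.card ((W ↪ V) × W) : ℝ) ≤
        (Fintype.card V : ℝ) ^ Fintype.card W * Fintype.card W := by
      rw [Fintype.card_prod, Nat.cast_mul]
      gcongr
      have := Fintype.card_le_of_injective (fun φ : W ↪ V => (φ : W → V)) DFunLike.coe_injective
      rw [Fintype.card_fun] at this
      exact_mod_cast this
    calc (B.card : ℝ) * x ^ k ≤ ∑ p, ((Bad p).card : ℝ) * x ^ k := by
          rw [← Finset.sum_mul]; gcongr
      _ ≤ ∑ _p : (W ↪ V) × W, 2 ^ Fintype.card (Finset V) * ((7 + x) / 8) ^ N :=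
          Finset.sum_le_sum fun p _ => hcard p
      _ ≤ _ := by
          rw [Finset.sum_const, Finset.card_univ, nsmul_eq_mul]
          gcongr
  have hB2 : 2 * B.card < 2 ^ Fintype.card (Finset V) := by
    have h : (2 * B.card : ℝ) * x ^ k < 2 ^ Fintype.card (Finset V) * x ^ k := by
      calc (2 * B.card : ℝ) * x ^ k = 2 * (B.card * x ^ k) := by ring
        _ ≤ 2 * ((Fintype.card V : ℝ) ^ Fintype.card W * Fintype.card W *
            (2 ^ Fintype.card (Finset V) * ((7 + x) / 8) ^ N)) := by gcongr
        _ = 2 ^ Fintype.card (Finset V) * (2 * ((Fintype.card V : ℝ) ^ Fintype.card W *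
            Fintype.card W * ((7 + x) / 8) ^ N)) := by ring
        _ < _ := by gcongr
    exact_mod_cast lt_of_mul_lt_mul_right h (by positivity)
  obtain ⟨A, hA⟩ : ∃ A, A ∉ B ∪ B.image compl := by
    by_contra! hall
    have h1 := Finset.card_union_le B (B.image compl)
    rw [Finset.eq_univ_iff_forall.2 hall, Finset.card_univ, Fintype.card_finset] at h1
    have h2 := Finset.card_image_le (s := B) (f := compl)
    omega
  rw [Finset.mem_union, not_or] at hA
  refine ⟨graphOfEdges A, fun h => hA.1 (hmem A h), fun h => hA.2 ?_⟩
  rw [compl_graphOfEdges] at h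
  exact Finset.mem_image.2 ⟨Aᶜ, hmem _ h, compl_compl A⟩

/-! ### Asymptotics -/

lemma distanceRamsey_pos {s t d : ℕ} (hs : 0 < s) (ht : 0 < t) (hd : 0 < d) :
    0 < distanceRamsey s t d := by
  by_contra h
  have hbound : ∀ {G : SimpleGraph (Fin (distanceRamsey s t d))} {r : ℕ}, 0 < r →
      ¬ HasInducedDistanceGraph G r d := by
    rintro G r hr ⟨S, hS, -⟩
    have := Finset.card_le_univ S
    rw [Fintype.card_fin] at this
    omega
  rcases distanceRamsey_mem s t hd ⊥ with h' | h'
  · exact hbound hs h'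
  · exact hbound ht h'

/-- At `n = distanceRamsey s s d` the first moment inequality of
`exists_graph_forall_not_hasInducedDistanceGraph` must fail. The hypothesis `hsδ` ensures that
distance graphs on `s` vertices have at most `δ * s ^ 3` triangles. -/
lemma le_two_mul_distanceRamsey_pow {s d : ℕ} (hs : 0 < s) (hd0 : 0 < d) (hd : d < 6) {x δ : ℝ}
    (hx0 : 0 < x) (hx1 : x ≤ 1) (hδ : 0 < δ) (hsδ : 9 ≤ δ ^ 27 * s) :
    x ^ ⌊δ * (s : ℝ) ^ 2⌋₊ ≤
      2 * ((distanceRamsey s s d : ℝ) ^ s * s * ((7 + x) / 8) ^ ((s ^ 2 - 3 * s) / 6)) := by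
  by_contra! hlt
  have : NeZero s := ⟨hs.ne'⟩
  have hs' : (0 : ℝ) < s := by exact_mod_cast hs
  have hcard : Fintype.card (ZMod s) = s := ZMod.card s
  obtain ⟨G, h1, h2⟩ := exists_graph_forall_not_hasInducedDistanceGraph (W := ZMod s)
    (V := Fin (distanceRamsey s s d)) (d := d) (k := ⌊δ * (s : ℝ) ^ 2⌋₊)
    (N := (s ^ 2 - 3 * s) / 6) hx0 hx1
    (fun H hH => by
      have h := card_triangles_pow_le (G := H) fun x y z => hH.not_completeTripartite hd
      rw [hcard] at h ⊢
      have h27 := h.trans (show 9 * (s : ℝ) ^ 80 ≤ (δ * (s : ℝ) ^ 3) ^ 27 by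
        calc 9 * (s : ℝ) ^ 80 ≤ δ ^ 27 * s * (s : ℝ) ^ 80 := by gcongr
          _ = _ := by ring)
      have hle := le_of_pow_le_pow_left₀ (by norm_num) (by positivity) h27
      have hfl := Nat.lt_floor_add_one (δ * (s : ℝ) ^ 2)
      have hlt3 := hle.trans_lt
        (show δ * (s : ℝ) ^ 3 < (⌊δ * (s : ℝ) ^ 2⌋₊ + 1) * (s : ℝ) by
          calc δ * (s : ℝ) ^ 3 = δ * (s : ℝ) ^ 2 * s := by ring
            _ < _ := by gcongr)
      exact_mod_cast hlt3)
    (fun c => by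
      have h := sq_card_le_card_tripleSystem c
      rw [hcard] at h
      omega)
    (by rw [hcard, Fintype.card_fin]; exact hlt)
  rw [hcard] at h1 h2
  rcases distanceRamsey_mem s s hd0 G with h | h
  · exact h1 h
  · exact h2 h

lemma eventually_le_log_distanceRamsey {d : ℕ} (hd0 : 0 < d) (hd : d < 6) {η : ℝ} (hη0 : 0 < η)
    (hη1 : η < 1) : ∀ᶠ s : ℕ in atTop,
      (s : ℝ) / 6 * (1 - η) * Real.log (8 / 7) ≤ Real.log (distanceRamsey s s d) := by
  set L := Real.log (8 / 7) with hL
  have hL0 : 0 < L := Real.log_pos (by norm_num)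
  have hL1 : L ≤ 1 := (Real.log_le_sub_one_of_pos (by norm_num)).trans (by norm_num)
  have hηL : 0 < η * L := by positivity
  -- A small weight `x` makes `(7 + x) / 8` almost `7 / 8`.
  obtain ⟨x, hx0, hx1, hxq⟩ : ∃ x : ℝ, 0 < x ∧ x < 1 ∧
      Real.log ((7 + x) / 8) ≤ -(L * (1 - η / 2)) := by
    have hc : ContinuousAt (fun x : ℝ => Real.log ((7 + x) / 8)) 0 :=
      ContinuousAt.log (by fun_prop) (by norm_num)
    have h0 : Real.log ((7 + 0) / 8) < -(L * (1 - η / 2)) := by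
      have : Real.log ((7 + 0) / 8) = -L := by
        rw [hL, ← Real.log_inv]
        norm_num
      rw [this]
      linarith
    have h1 := (hc.eventually_lt continuousAt_const h0).filter_mono
      (nhdsWithin_le_nhds (s := Set.Ioi 0))
    have h2 : ∀ᶠ x : ℝ in 𝓝[>] 0, x ∈ Set.Ioo (0 : ℝ) 1 := Ioo_mem_nhdsGT one_pos
    obtain ⟨x, ha, hb⟩ := (h1.and h2).exists
    exact ⟨x, hb.1, hb.2, ha.le⟩
  -- With this `δ` the factor `x ^ (δ * s ^ 2)` costs only `η * L / 24` in the exponent of `s ^ 2`.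
  set Λ := -Real.log x with hΛ
  have hΛ0 : 0 < Λ := neg_pos.2 (Real.log_neg hx0 hx1)
  set δ := η * L / (24 * Λ) with hδ
  have hδ0 : 0 < δ := by positivity
  have hδΛ : δ * Λ = η * L / 24 := by
    rw [hδ]
    field_simp
  filter_upwards [eventually_gt_atTop 0,
    tendsto_natCast_atTop_atTop.eventually_ge_atTop (9 / δ ^ 27),
    tendsto_natCast_atTop_atTop.eventually_gt_atTop (96 / (η * L))] with s hs hsδ hsη
  rw [div_le_iff₀' (by positivity)] at hsδ
  rw [div_lt_iff₀' hηL] at hsη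
  have hs1 : (1 : ℝ) ≤ s := by exact_mod_cast hs
  by_contra! hlt
  have hR : (0 : ℝ) < distanceRamsey s s d := by exact_mod_cast distanceRamsey_pos hs hs hd0
  have hmain := Real.log_le_log (by positivity)
    (le_two_mul_distanceRamsey_pow hs hd0 hd hx0 hx1.le hδ0 hsδ)
  rw [Real.log_pow, Real.log_mul (by norm_num) (by positivity),
    Real.log_mul (by positivity) (by positivity), Real.log_mul (by positivity) (by positivity),
    Real.log_pow, Real.log_pow] at hmain
  have hk : (⌊δ * (s : ℝ) ^ 2⌋₊ : ℝ) ≤ δ * (s : ℝ) ^ 2 := Nat.floor_le (by positivity)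
  have hN : ((s : ℝ) ^ 2 - 3 * s) / 6 - 1 ≤ (((s ^ 2 - 3 * s) / 6 : ℕ) : ℝ) := by
    have : s ^ 2 ≤ 6 * ((s ^ 2 - 3 * s) / 6) + 6 + 3 * s := by omega
    have : (s : ℝ) ^ 2 ≤ 6 * (((s ^ 2 - 3 * s) / 6 : ℕ) : ℝ) + 6 + 3 * s := by exact_mod_cast this
    linarith
  have hlog2 : Real.log 2 ≤ 1 := (Real.log_le_sub_one_of_pos (by norm_num)).trans (by norm_num)
  have hlogs : Real.log s ≤ s := (Real.log_le_sub_one_of_pos (by positivity)).trans (by linarith)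
  have hn : (s : ℝ) * Real.log (distanceRamsey s s d) ≤ s * (s / 6 * (1 - η) * L) := by gcongr
  have hkx : -(η * L / 24 * (s : ℝ) ^ 2) ≤ ⌊δ * (s : ℝ) ^ 2⌋₊ * Real.log x := by
    have : (⌊δ * (s : ℝ) ^ 2⌋₊ : ℝ) * Λ ≤ δ * (s : ℝ) ^ 2 * Λ := by gcongr
    rw [hΛ] at this hδΛ
    linear_combination this + (s : ℝ) ^ 2 * hδΛ
  set l := L * (1 - η / 2) with hl
  have hl0 : 0 ≤ l := by
    have : 0 ≤ 1 - η / 2 := by linarith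
    positivity
  have hl1 : l ≤ 1 := by
    have : L * η ≥ 0 := by positivity
    linarith
  have hNq : (((s ^ 2 - 3 * s) / 6 : ℕ) : ℝ) * Real.log ((7 + x) / 8) ≤
      -(l * (((s : ℝ) ^ 2 - 3 * s) / 6 - 1)) := by
    calc _ ≤ (((s ^ 2 - 3 * s) / 6 : ℕ) : ℝ) * -l := by gcongr
      _ = -(l * (((s ^ 2 - 3 * s) / 6 : ℕ) : ℝ)) := by ring
      _ ≤ _ := by gcongr
  have hls : l * (s / 2 + 1) ≤ 1 * (s / 2 + 1) := by gcongr
  -- The quadratic terms leave a gap `η * L / 24 * s ^ 2`, which exceeds the lower-order terms, at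
  -- most `4 * s` in total.
  have hfin : 96 * (s : ℝ) < η * L * s * s := by gcongr
  rw [hl] at hNq hls
  linarith

theorem mainTheorem7 :
    (∀ d : ℕ, d = 4 ∨ d = 5 →
      ∃ ε : ℕ → ℝ, Tendsto ε atTop (𝓝 0) ∧
        ∀ s : ℕ, 1 ≤ s →
          (8 / 7 : ℝ) ^ ((s : ℝ) / 6 * (1 + ε s)) ≤ (distanceRamsey s s d : ℝ)) ∧
    |Real.logb 2 (8 / 7) / 6 - 0.032107| < 1 / 10 ^ 6 := by
  refine ⟨fun d hd45 => ?_, abs_logb_two_eight_div_seven_sub_lt⟩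
  have hd0 : 0 < d := by omega
  have hd : d < 6 := by omega
  have hL0 : 0 < Real.log (8 / 7) := Real.log_pos (by norm_num)
  -- The largest admissible `ε`, truncated at `0`: only its negative part has to be controlled.
  refine ⟨fun s => min 0 (Real.log (distanceRamsey s s d) / (s / 6 * Real.log (8 / 7)) - 1),
    ?_, fun s hs => ?_⟩
  · refine tendsto_order.2 ⟨fun a ha => ?_, fun a ha => ?_⟩
    · have hη0 : 0 < min (-a / 2) (1 / 2) := lt_min (by linarith) (by norm_num)
      have hη1 : min (-a / 2) (1 / 2) < 1 := (min_le_right _ _).trans_lt (by norm_num)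
      filter_upwards [eventually_le_log_distanceRamsey hd0 hd hη0 hη1, eventually_gt_atTop 0]
        with s hs hs0
      have hs0' : (0 : ℝ) < s := by exact_mod_cast hs0
      refine lt_min ha ?_
      have h : 1 - min (-a / 2) (1 / 2) ≤
          Real.log (distanceRamsey s s d) / (s / 6 * Real.log (8 / 7)) := by
        rw [le_div_iff₀ (by positivity)]
        linarith
      linarith [min_le_left (-a / 2) (1 / 2)]
    · exact Eventually.of_forall fun s => (min_le_left _ _).trans_lt ha
  · have hs0 : (0 : ℝ) < s := by exact_mod_cast hs
    have hR : (0 : ℝ) < distanceRamsey s s d := by exact_mod_cast distanceRamsey_pos hs hs hd0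
    rw [Real.rpow_def_of_pos (by norm_num), ← Real.le_log_iff_exp_le hR]
    have h := min_le_right (0 : ℝ)
      (Real.log (distanceRamsey s s d) / (s / 6 * Real.log (8 / 7)) - 1)
    have h' : 1 + min 0 (Real.log (distanceRamsey s s d) / (s / 6 * Real.log (8 / 7)) - 1) ≤
        Real.log (distanceRamsey s s d) / (s / 6 * Real.log (8 / 7)) := by linarith
    rw [le_div_iff₀ (by positivity)] at h'
    linarith
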